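/- Let $w(x)=\dfrac{|x+\frac12|}{\sqrt{1+x}}+\dfrac{|x-\frac12|}{\sqrt{1-x}}$ for $-1<x<1$. There is a sequence of positive real numbers $(\gamma_n)_{n\ge1}$ such that $$\gamma_1=\tfrac12,\qquad \gamma_{3n+2}=\tfrac14,\qquad \gamma_{3n+3}+\gamma_{3n+4}=\tfrac12\qquad(n\ge 0),$$ $$\gamma_3=\tfrac{7}{30},\quad \gamma_4=\tfrac{4}{15},\quad \gamma_6=\tfrac{12}{49},\quad \gamma_7=\tfrac{25}{98},\quad \gamma_9=\tfrac{3187}{12870},\quad \gamma_{10}=\tfrac{1624}{6435},$$ and such that the polynomials $(P_n)_{n\ge0}$ defined by $$P_0(x)=1,\qquad P_1(x)=x,\qquad P_{n+2}(x)=xP_{n+1}(x)-\gamma_{n+1}P_n(x)\quad(n\ge0)$$ form an orthogonal polynomial sequence with respect to the weight $w$ on $(-1,1)$; that is, $P_n$ has degree exactly $n$ for every $n\ge0$, $p\,w$ is integrable on $(-1,1)$ for every real polynomial $p$, $\int_{-1}^1 P_m(x)P_n(x)w(x)\,dx=0$ whenever $m\ne n$, and $\int_{-1}^1 P_n(x)^2w(x)\,dx>0$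 for every $n\ge0$. -/

import Mathlib

open Polynomial MeasureTheory

/-- The polynomials `P 0 = 1`, `P 1 = x`, `P (n+2) = x * P (n+1) - γ (n+1) * P n`.
The value `γ 0` plays no role. -/
noncomputable def recPoly (γ : ℕ → ℝ) : ℕ → ℝ[X]
  | 0 => 1
  | 1 => X
  | n + 2 => X * recPoly γ (n + 1) - C (γ (n + 1)) * recPoly γ n

/-- The weight function `|x + 1/2| / √(1 + x) + |x - 1/2| / √(1 - x)`. -/
noncomputable def atiaWeight (x : ℝ) : ℝ :=
  |x + 1 / 2| / √(1 + x) + |x - 1 / 2| / √(1 - x)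

/-- `P` is an orthogonal polynomial sequence with respect to the weight `w` on `(a, b)`:
`P n` has exact degree `n`, every polynomial is integrable against `w`,
distinct `P m`, `P n` are orthogonal, and each `P n` has positive square norm. -/
structure IsOrthogonalSeq (P : ℕ → ℝ[X]) (w : ℝ → ℝ) (a b : ℝ) : Prop where
  degree_eq : ∀ n, (P n).degree = n
  integrable : ∀ p : ℝ[X], IntegrableOn (fun x => p.eval x * w x) (Set.Ioo a b)
  orthogonal : ∀ m n, m ≠ n →
    ∫ x in Set.Ioo a b, (P m).eval x * (P n).eval x * w x = 0
  norm_pos : ∀ n, 0 < ∫ x in Set.Ioo a b, (P n).eval x ^ 2 * w x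

/-! Under `x = cos θ` the measure `w(x) dx` becomes a constant times `h(3θ) dθ`, with `h(φ) =
|sin(φ/2)| + |cos(φ/2)|`. It depends on `θ` only through `3θ`, so averaging over `θ, θ ± 2π/3` shows
that, against any polynomial in `T = 4x³ - 3x = cos 3θ`, the factor `x` integrates to 0 and `x²`
acts as `1/2` (`isCubicSieved_trigFunctional`).

Let `Q_n` be the monic orthogonal polynomials of the pullback functional (weight `h(φ) dφ`, variable
`cos φ`) and `δ_n` their coefficients. Reducing powers of `x` by `4x³ = T + 3x` gives `P_{3n} = 4⁻ⁿ
Q_n(T)` (`recPoly_three_mul`). Evaluating `L(x² P_{3n}²)` and `L(x⁴ P_{3n}²)` both by sieving and by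
the recurrence yields `γ_{3n+3} + γ_{3n+4} = 1/2` and `γ_{3n+2} = 1/4`; comparing norms of `P_{3n}`
and `Q_n` yields `γ_{3n+1} γ_{3n+3} = δ_{n+1} / 4`. Starting from `γ_1 = 1/2`, the listed values
follow from `δ_1, δ_2, δ_3`, computed from the first moments. -/

/-- A linear functional on real polynomials is positive definite. -/
def PosDefFunctional (L : ℝ[X] →ₗ[ℝ] ℝ) : Prop :=
  ∀ p : ℝ[X], p ≠ 0 → 0 < L (p ^ 2)

/-- A linear functional on real polynomials is symmetric, i.e. its odd moments vanish. -/
def SymmFunctional (L : ℝ[X] →ₗ[ℝ] ℝ) : Prop :=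
  ∀ p : ℝ[X], L (p.comp (-X)) = L p

/-- The monic orthogonal polynomials of a symmetric positive definite functional. -/
noncomputable def monicOrthogonal (L : ℝ[X] →ₗ[ℝ] ℝ) : ℕ → ℝ[X]
  | 0 => 1
  | 1 => X
  | n + 2 => X * monicOrthogonal L (n + 1) -
      C (L (monicOrthogonal L (n + 1) ^ 2) / L (monicOrthogonal L n ^ 2)) * monicOrthogonal L n

/-- The recurrence coefficients of the monic orthogonal polynomials of `L`. -/
noncomputable def recCoeff (L : ℝ[X] →ₗ[ℝ] ℝ) (n : ℕ) : ℝ :=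
  L (monicOrthogonal L n ^ 2) / L (monicOrthogonal L (n - 1) ^ 2)

/-! ### Polynomials defined by a symmetric three-term recurrence -/

theorem recPoly_add_two (γ : ℕ → ℝ) (n : ℕ) :
    recPoly γ (n + 2) = X * recPoly γ (n + 1) - C (γ (n + 1)) * recPoly γ n := by
  rw [recPoly]

theorem recPoly_monic_natDegree (γ : ℕ → ℝ) (n : ℕ) :
    (recPoly γ n).Monic ∧ (recPoly γ n).natDegree = n := by
  induction n using Nat.strong_induction_on with
  | _ n ih =>
    match n with
    | 0 => simp [recPoly]
    | 1 => simp [recPoly]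
    | n + 2 =>
      obtain ⟨h1, h2⟩ := ih (n + 1) (by omega)
      obtain ⟨h3, h4⟩ := ih n (by omega)
      have hm : (X * recPoly γ (n + 1)).Monic := monic_X.mul h1
      have hd : (X * recPoly γ (n + 1)).natDegree = n + 2 := by
        rw [monic_X.natDegree_mul h1, natDegree_X, h2]; ring
      have hlt : (C (γ (n + 1)) * recPoly γ n).degree < (X * recPoly γ (n + 1)).degree := by
        rw [degree_eq_natDegree hm.ne_zero, hd]
        refine (degree_mul_le _ _).trans_lt ?_
        rw [degree_eq_natDegree h3.ne_zero, h4]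
        refine (add_le_add_left degree_C_le _).trans_lt ?_
        rw [zero_add]
        exact_mod_cast (by omega : n < n + 2)
      rw [recPoly_add_two]
      refine ⟨hm.sub_of_left hlt, natDegree_eq_of_degree_eq_some ?_⟩
      rw [degree_sub_eq_left_of_degree_lt hlt, degree_eq_natDegree hm.ne_zero, hd]

theorem recPoly_monic (γ : ℕ → ℝ) (n : ℕ) : (recPoly γ n).Monic :=
  (recPoly_monic_natDegree γ n).1

theorem recPoly_natDegree (γ : ℕ → ℝ) (n : ℕ) : (recPoly γ n).natDegree = n :=
  (recPoly_monic_natDegree γ n).2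

theorem recPoly_degree (γ : ℕ → ℝ) (n : ℕ) : (recPoly γ n).degree = n := by
  rw [degree_eq_natDegree (recPoly_monic γ n).ne_zero, recPoly_natDegree]

theorem recPoly_comp_neg_X (γ : ℕ → ℝ) (n : ℕ) :
    (recPoly γ n).comp (-X) = (-1) ^ n * recPoly γ n := by
  induction n using Nat.strong_induction_on with
  | _ n ih =>
    match n with
    | 0 => simp [recPoly]
    | 1 => simp [recPoly]
    | n + 2 =>
      rw [recPoly_add_two, sub_comp, mul_comp, mul_comp, ih n (by omega), ih (n + 1) (by omega),
        X_comp, C_comp]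
      ring

/-- `monicOrthogonal` is built directly from `L`, so that `recCoeff` is not circular; this
identification transfers the general facts on `recPoly` to it. -/
theorem recPoly_recCoeff (L : ℝ[X] →ₗ[ℝ] ℝ) (n : ℕ) :
    recPoly (recCoeff L) n = monicOrthogonal L n := by
  induction n using Nat.strong_induction_on with
  | _ n ih =>
    match n with
    | 0 => rfl
    | 1 => rfl
    | n + 2 =>
      rw [recPoly_add_two, ih n (by omega), ih (n + 1) (by omega), monicOrthogonal, recCoeff]
      rfl

/-! ### Orthogonality for symmetric positive definite functionals -/

section Orthogonal

variable {L : ℝ[X] →ₗ[ℝ] ℝ}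

theorem recCoeff_succ_mul (hL : PosDefFunctional L) (n : ℕ) :
    recCoeff L (n + 1) * L (recPoly (recCoeff L) n ^ 2) = L (recPoly (recCoeff L) (n + 1) ^ 2) := by
  have h := hL _ (recPoly_monic (recCoeff L) n).ne_zero
  simp only [recPoly_recCoeff] at h ⊢
  rw [recCoeff, Nat.add_sub_cancel]
  exact div_mul_cancel₀ _ h.ne'

theorem recCoeff_succ_pos (hL : PosDefFunctional L) (n : ℕ) : 0 < recCoeff L (n + 1) := by
  have h1 := hL _ (recPoly_monic (recCoeff L) n).ne_zero
  have h2 := hL _ (recPoly_monic (recCoeff L) (n + 1)).ne_zero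
  rw [← recCoeff_succ_mul hL] at h2
  exact (mul_pos_iff_of_pos_right h1).1 h2

theorem SymmFunctional.apply_X_mul_sq (hs : SymmFunctional L) (γ : ℕ → ℝ) (n : ℕ) :
    L (X * recPoly γ n ^ 2) = 0 := by
  have h := hs (X * recPoly γ n ^ 2)
  rw [mul_comp, pow_comp, recPoly_comp_neg_X, X_comp, mul_pow, ← pow_mul, mul_comm n 2, pow_mul,
    neg_one_sq, one_pow, one_mul, neg_mul, map_neg] at h
  linarith

theorem map_C_mul (L : ℝ[X] →ₗ[ℝ] ℝ) (a : ℝ) (p : ℝ[X]) : L (C a * p) = a * L p := by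
  rw [← smul_eq_C_mul, map_smul, smul_eq_mul]

/-- The recurrence moves the factor `X` onto the lower polynomial. The top case `m = n + 1` vanishes
by parity, `m = n` by the choice of coefficient as a ratio of norms, and the others by induction. -/
theorem map_recPoly_mul_of_lt (hL : PosDefFunctional L) (hs : SymmFunctional L) (n : ℕ) :
    ∀ m < n, L (recPoly (recCoeff L) n * recPoly (recCoeff L) m) = 0 := by
  induction n using Nat.strong_induction_on with
  | _ n ih =>
    intro m hm
    set γ := recCoeff L with hγ
    match n, m with
    | 0, m => omega
    | 1, 0 => simpa [recPoly] using hs.apply_X_mul_sq γ 0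
    | 1, m + 1 => omega
    | n + 2, m =>
      have hX : recPoly γ (n + 2) * recPoly γ m = recPoly γ (n + 1) * (X * recPoly γ m)
          - C (γ (n + 1)) * (recPoly γ n * recPoly γ m) := by
        rw [recPoly_add_two]; ring
      rw [hX, map_sub, map_C_mul]
      obtain rfl | rfl | hlt : m = n + 1 ∨ m = n ∨ m < n := by omega
      · rw [mul_comm (recPoly γ n), ih (n + 1) (by omega) n (by omega),
          show recPoly γ (n + 1) * (X * recPoly γ (n + 1)) = X * recPoly γ (n + 1) ^ 2 by ring,
          hs.apply_X_mul_sq]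
        ring
      · rw [← sq, hγ, recCoeff_succ_mul hL, ← hγ]
        match m with
        | 0 => rw [show X * recPoly γ 0 = recPoly γ 1 by simp [recPoly], ← sq, sub_self]
        | m + 1 =>
          rw [show X * recPoly γ (m + 1) = recPoly γ (m + 2) + C (γ (m + 1)) * recPoly γ m by
            rw [recPoly_add_two]; ring, mul_add, map_add, mul_left_comm, map_C_mul,
            ih (m + 2) (by omega) m (by omega), ← sq]
          ring
      · rw [ih n (by omega) m hlt]
        match m with
        | 0 =>
          rw [show X * recPoly γ 0 = recPoly γ 1 by simp [recPoly],
            ih (n + 1) (by omega) 1 (by omega)]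
          ring
        | m + 1 =>
          rw [show X * recPoly γ (m + 1) = recPoly γ (m + 2) + C (γ (m + 1)) * recPoly γ m by
            rw [recPoly_add_two]; ring, mul_add, map_add, mul_left_comm, map_C_mul,
            ih (n + 1) (by omega) m (by omega), ih (n + 1) (by omega) (m + 2) (by omega)]
          ring

theorem map_recPoly_mul_of_ne (hL : PosDefFunctional L) (hs : SymmFunctional L) {m n : ℕ}
    (h : m ≠ n) : L (recPoly (recCoeff L) m * recPoly (recCoeff L) n) = 0 := by
  rcases h.lt_or_gt with h | h
  · rw [mul_comm]; exact map_recPoly_mul_of_lt hL hs n m h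
  · exact map_recPoly_mul_of_lt hL hs m n h

theorem map_recPoly_mul_of_degree_lt (hL : PosDefFunctional L) (hs : SymmFunctional L) {n : ℕ}
    {p : ℝ[X]} (hp : p.degree < n) : L (recPoly (recCoeff L) n * p) = 0 := by
  set S : Polynomial.Sequence ℝ := ⟨recPoly (recCoeff L), recPoly_degree _⟩
  have hmem : p ∈ Submodule.span ℝ (S '' Set.Iio n) := by
    rw [S.span_degreeLT]
    · exact mem_degreeLT.2 hp
    · intro i _
      rw [show (S i).leadingCoeff = 1 from recPoly_monic _ i]
      exact isUnit_one
  clear hp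
  induction hmem using Submodule.span_induction with
  | mem x hx =>
    obtain ⟨m, hm, rfl⟩ := hx
    exact map_recPoly_mul_of_lt hL hs n m hm
  | zero => simp
  | add x y _ _ hx hy => rw [mul_add, map_add, hx, hy, add_zero]
  | smul a x _ hx => rw [mul_smul_comm, map_smul, hx, smul_zero]

/-- A monic polynomial of degree `n` orthogonal to all polynomials of lower degree is the `n`-th
monic orthogonal polynomial. -/
theorem eq_recPoly_recCoeff (hL : PosDefFunctional L) (hs : SymmFunctional L) {n : ℕ} {q : ℝ[X]}
    (hq : q.Monic) (hdeg : q.natDegree = n) (horth : ∀ p : ℝ[X], p.degree < n → L (q * p) = 0) :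
    recPoly (recCoeff L) n = q := by
  by_contra hne
  set P := recPoly (recCoeff L) n with hP
  have hd : (P - q).degree < n := by
    rw [← recPoly_degree (recCoeff L) n]
    refine degree_sub_lt_left ?_ (recPoly_monic _ n).ne_zero ?_
    · rw [recPoly_degree, degree_eq_natDegree hq.ne_zero, hdeg]
    · rw [(recPoly_monic _ n).leadingCoeff, hq.leadingCoeff]
  have h := hL _ (sub_ne_zero.2 hne)
  rw [sq, sub_mul, map_sub, map_recPoly_mul_of_degree_lt hL hs hd, horth _ hd] at h
  simp at h

/-- Pythagoras applied to `x P_{n+1} = P_{n+2} + γ_{n+1} P_n`. -/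
theorem map_X_sq_mul_recPoly_sq (hL : PosDefFunctional L) (hs : SymmFunctional L) (n : ℕ) :
    L (X ^ 2 * recPoly (recCoeff L) (n + 1) ^ 2) =
      (recCoeff L (n + 1) + recCoeff L (n + 2)) * L (recPoly (recCoeff L) (n + 1) ^ 2) := by
  set γ := recCoeff L with hγ
  have h : X ^ 2 * recPoly γ (n + 1) ^ 2 = recPoly γ (n + 2) ^ 2
      + C (2 * γ (n + 1)) * (recPoly γ (n + 2) * recPoly γ n)
      + C (γ (n + 1) ^ 2) * recPoly γ n ^ 2 := by
    rw [recPoly_add_two, C_mul, C_pow, C_ofNat]; ring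
  have h1 := recCoeff_succ_mul hL n
  have h2 := recCoeff_succ_mul hL (n + 1)
  rw [← hγ] at h1 h2
  rw [h, map_add, map_add, map_C_mul, map_C_mul, hγ,
    map_recPoly_mul_of_ne hL hs (by omega : n + 2 ≠ n), ← hγ, ← h2, ← h1]
  ring

/-- Pythagoras applied to the three-term expansion of `x² P_{n+2}` in `P_{n+4}, P_{n+2}, P_n`. -/
theorem map_X_pow_four_mul_recPoly_sq (hL : PosDefFunctional L) (hs : SymmFunctional L) (n : ℕ) :
    L (X ^ 4 * recPoly (recCoeff L) (n + 2) ^ 2) =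
      (recCoeff L (n + 2) * recCoeff L (n + 1) + (recCoeff L (n + 2) + recCoeff L (n + 3)) ^ 2
        + recCoeff L (n + 3) * recCoeff L (n + 4)) * L (recPoly (recCoeff L) (n + 2) ^ 2) := by
  set γ := recCoeff L with hγ
  have h : X ^ 4 * recPoly γ (n + 2) ^ 2 = (recPoly γ (n + 4)
      + C (γ (n + 3) + γ (n + 2)) * recPoly γ (n + 2)
      + C (γ (n + 2) * γ (n + 1)) * recPoly γ n) ^ 2 := by
    rw [recPoly_add_two γ (n + 2), recPoly_add_two γ (n + 1), C_mul, C_add]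
    have := recPoly_add_two γ n
    have e : C (γ (n + 2)) * (X * recPoly γ (n + 1)) = C (γ (n + 2)) * (recPoly γ (n + 2) +
      C (γ (n + 1)) * recPoly γ n) := by rw [this]; ring
    rw [show X * (X * recPoly γ (n + 2) - C (γ (n + 1 + 1)) * recPoly γ (n + 1)) =
      X * (X * recPoly γ (n + 2)) - C (γ (n + 2)) * (X * recPoly γ (n + 1)) by ring_nf, e]
    ring_nf
  have h' : ∀ a b : ℝ, ∀ p q r : ℝ[X], L ((p + C a * q + C b * r) ^ 2) =
      L (p ^ 2) + a ^ 2 * L (q ^ 2) + b ^ 2 * L (r ^ 2)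
      + 2 * a * L (p * q) + 2 * b * L (p * r) + 2 * a * b * L (q * r) := by
    intro a b p q r
    simp only [← map_C_mul, ← map_add]
    congr 1
    simp only [C_mul, C_pow, C_ofNat]
    ring
  rw [h, h', hγ, map_recPoly_mul_of_ne hL hs (by omega : n + 4 ≠ n + 2),
    map_recPoly_mul_of_ne hL hs (by omega : n + 4 ≠ n),
    map_recPoly_mul_of_ne hL hs (by omega : n + 2 ≠ n), ← hγ]
  have h1 := recCoeff_succ_mul hL n
  have h2 := recCoeff_succ_mul hL (n + 1)
  have h3 := recCoeff_succ_mul hL (n + 2)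
  have h4 := recCoeff_succ_mul hL (n + 3)
  simp only [← hγ, add_assoc, Nat.reduceAdd] at h1 h2 h3 h4
  rw [← h4, ← h3, ← h2, ← h1]
  ring

end Orthogonal

/-! ### Cubic sieving -/

/-- The Chebyshev cubic `4 x ^ 3 - 3 x`. -/
noncomputable def chebyshevCubic : ℝ[X] := C 4 * X ^ 3 - C 3 * X

theorem chebyshevCubic_natDegree : chebyshevCubic.natDegree = 3 := by
  unfold chebyshevCubic; compute_degree!

theorem chebyshevCubic_leadingCoeff : chebyshevCubic.leadingCoeff = 4 := by
  rw [leadingCoeff, chebyshevCubic_natDegree, chebyshevCubic]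
  simp [coeff_X_pow]

theorem chebyshevCubic_comp_neg_X : chebyshevCubic.comp (-X) = -chebyshevCubic := by
  simp only [chebyshevCubic, sub_comp, mul_comp, C_comp, X_comp, pow_comp]; ring

/-- The functional `q ↦ L (q (4 x ^ 3 - 3 x))`. -/
noncomputable def cubicPullback (L : ℝ[X] →ₗ[ℝ] ℝ) : ℝ[X] →ₗ[ℝ] ℝ where
  toFun q := L (q.comp chebyshevCubic)
  map_add' p q := by simp
  map_smul' a p := by simp

theorem cubicPullback_apply (L : ℝ[X] →ₗ[ℝ] ℝ) (q : ℝ[X]) :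
    cubicPullback L q = L (q.comp chebyshevCubic) := rfl

/-- `L` behaves like integration against a weight on `(-1, 1)` that, in the variable
`x = cos θ`, is a function of `cos 3θ`. -/
def IsCubicSieved (L : ℝ[X] →ₗ[ℝ] ℝ) : Prop :=
  ∀ q : ℝ[X], L (q.comp chebyshevCubic * X) = 0 ∧
    L (q.comp chebyshevCubic * X ^ 2) = 1 / 2 * L (q.comp chebyshevCubic)

section Sieved

variable {L : ℝ[X] →ₗ[ℝ] ℝ}

theorem PosDefFunctional.cubicPullback (hL : PosDefFunctional L) :
    PosDefFunctional (cubicPullback L) := by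
  intro p hp
  rw [cubicPullback_apply, pow_comp]
  refine hL _ fun h => ?_
  rcases comp_eq_zero_iff.1 h with h | ⟨_, h⟩
  · exact hp h
  · have := congrArg natDegree h
    rw [chebyshevCubic_natDegree, natDegree_C] at this
    omega

theorem SymmFunctional.cubicPullback (hs : SymmFunctional L) :
    SymmFunctional (cubicPullback L) := by
  intro p
  rw [cubicPullback_apply, cubicPullback_apply, ← hs (p.comp chebyshevCubic), comp_assoc,
    comp_assoc, chebyshevCubic_comp_neg_X, neg_comp, X_comp]

theorem map_comp_mul_X_pow_add_three (L : ℝ[X] →ₗ[ℝ] ℝ) (q : ℝ[X]) (k : ℕ) :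
    L (q.comp chebyshevCubic * X ^ (k + 3)) =
      1 / 4 * L ((q * X).comp chebyshevCubic * X ^ k)
        + 3 / 4 * L (q.comp chebyshevCubic * X ^ (k + 1)) := by
  rw [← map_C_mul, ← map_C_mul, ← map_add]
  congr 1
  rw [mul_comp, X_comp]
  nth_rw 3 [chebyshevCubic]
  have h1 : (C (1 / 4) * C 4 : ℝ[X]) = 1 := by rw [← C_mul]; norm_num
  have h2 : (C (3 / 4) : ℝ[X]) = C (1 / 4) * C 3 := by rw [← C_mul]; norm_num
  rw [h2]
  linear_combination (-q.comp chebyshevCubic * X ^ (k + 3)) * h1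

/-- Give `T` weight 3 and `x` weight 1. Trading `x³` for `(T + 3x)/4` never raises the weight `k +
3i` and lowers `k`, down to `k ≤ 2`, where sieving and the orthogonality of `Q_n` finish. -/
theorem map_comp_mul_X_pow_eq_zero (hL : PosDefFunctional L) (hs : SymmFunctional L)
    (hc : IsCubicSieved L) (n k : ℕ) : ∀ i, k + 3 * i < 3 * n →
      L ((recPoly (recCoeff (cubicPullback L)) n * X ^ i).comp chebyshevCubic * X ^ k) = 0 := by
  have hzero : ∀ i < n,
      L ((recPoly (recCoeff (cubicPullback L)) n * X ^ i).comp chebyshevCubic) = 0 := by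
    intro i hi
    rw [← cubicPullback_apply]
    exact map_recPoly_mul_of_degree_lt hL.cubicPullback hs.cubicPullback
      (by rw [degree_X_pow]; exact_mod_cast hi)
  induction k using Nat.strong_induction_on with
  | _ k ih =>
    intro i hi
    match k with
    | 0 => rw [pow_zero, mul_one, hzero i (by omega)]
    | 1 => rw [pow_one, (hc _).1]
    | 2 => rw [(hc _).2, hzero i (by omega), mul_zero]
    | k + 3 =>
      rw [map_comp_mul_X_pow_add_three, ih (k + 1) (by omega) i (by omega), mul_assoc, ← pow_succ,
        ih k (by omega) (i + 1) (by omega)]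
      ring

theorem map_comp_mul_eq_zero (hL : PosDefFunctional L) (hs : SymmFunctional L)
    (hc : IsCubicSieved L) (n : ℕ) (p : ℝ[X]) (hp : p.degree < (3 * n : ℕ)) :
    L ((recPoly (recCoeff (cubicPullback L)) n).comp chebyshevCubic * p) = 0 := by
  rw [← mem_degreeLT, degreeLT_eq_span_X_pow] at hp
  induction hp using Submodule.span_induction with
  | mem x hx =>
    simp only [Finset.coe_image, Set.mem_image, Finset.coe_range, Set.mem_Iio] at hx
    obtain ⟨k, hk, rfl⟩ := hx
    simpa using map_comp_mul_X_pow_eq_zero hL hs hc n k 0 (by omega)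
  | zero => simp
  | add x y _ _ hx hy => rw [mul_add, map_add, hx, hy, add_zero]
  | smul a x _ hx => rw [mul_smul_comm, map_smul, hx, smul_zero]

theorem recPoly_three_mul (hL : PosDefFunctional L) (hs : SymmFunctional L)
    (hc : IsCubicSieved L) (n : ℕ) : recPoly (recCoeff L) (3 * n) =
      (C ((4 ^ n)⁻¹) * recPoly (recCoeff (cubicPullback L)) n).comp chebyshevCubic := by
  set Q := recPoly (recCoeff (cubicPullback L)) n with hQ
  rw [mul_comp, C_comp]
  have hne : ((4 : ℝ) ^ n)⁻¹ ≠ 0 := by positivity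
  refine eq_recPoly_recCoeff hL hs ?_ ?_ ?_
  · rw [Monic, leadingCoeff_mul, leadingCoeff_C,
      leadingCoeff_comp (by rw [chebyshevCubic_natDegree]; omega), recPoly_monic,
      chebyshevCubic_leadingCoeff, recPoly_natDegree, one_mul]
    exact inv_mul_cancel₀ (by positivity)
  · rw [natDegree_C_mul hne, natDegree_comp, chebyshevCubic_natDegree, recPoly_natDegree, mul_comm]
  · intro p hp
    rw [mul_assoc, map_C_mul, map_comp_mul_eq_zero hL hs hc n p hp, mul_zero]

theorem recCoeff_one (hL : PosDefFunctional L) (hc : IsCubicSieved L) : recCoeff L 1 = 1 / 2 := by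
  have h := recCoeff_succ_mul hL 0
  have h0 := hL 1 one_ne_zero
  have h2 := (hc 1).2
  simp only [recPoly, one_comp, one_mul, one_pow, zero_add] at h h0 h2
  rw [h2] at h
  exact mul_right_cancel₀ h0.ne' h

theorem recCoeff_three_mul_add (hL : PosDefFunctional L) (hs : SymmFunctional L)
    (hc : IsCubicSieved L) (n : ℕ) : recCoeff L (3 * n + 3) + recCoeff L (3 * n + 4) = 1 / 2 := by
  have h := map_X_sq_mul_recPoly_sq hL hs (3 * n + 2)
  have h0 := hL _ (recPoly_monic (recCoeff L) (3 * n + 2 + 1)).ne_zero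
  refine mul_right_cancel₀ h0.ne' (h.symm.trans ?_)
  rw [show 3 * n + 2 + 1 = 3 * (n + 1) by ring, recPoly_three_mul hL hs hc, ← pow_comp,
    mul_comm, (hc _).2]

theorem IsCubicSieved.map_comp_mul_X_pow_four (hc : IsCubicSieved L) (q : ℝ[X]) :
    L (q.comp chebyshevCubic * X ^ 4) = 3 / 8 * L (q.comp chebyshevCubic) := by
  rw [map_comp_mul_X_pow_add_three L q 1, pow_one, (hc _).1, (hc _).2]
  ring

/-- The fourth-power identity for `P_{3n+3}` links the claim at `n + 1` to the claim at `n`; the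
base case uses `x² P_1² = x⁴`. -/
theorem recCoeff_three_mul_add_two (hL : PosDefFunctional L) (hs : SymmFunctional L)
    (hc : IsCubicSieved L) (n : ℕ) : recCoeff L (3 * n + 2) = 1 / 4 := by
  induction n with
  | zero =>
    have h1 := map_X_sq_mul_recPoly_sq hL hs 0
    have h2 := hc.map_comp_mul_X_pow_four 1
    have h3 := (hc 1).2
    have h0 := hL 1 one_ne_zero
    simp only [recPoly, one_comp, one_mul, one_pow, zero_add, recCoeff_one hL hc] at h0 h1 h2 h3
    rw [← pow_add, h3, h2] at h1
    rw [mul_zero, zero_add]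
    have : recCoeff L 2 * L 1 = 1 / 4 * L 1 := by linarith
    exact mul_right_cancel₀ h0.ne' this
  | succ n ih =>
    have h := map_X_pow_four_mul_recPoly_sq hL hs (3 * n + 1)
    have h0 := hL _ (recPoly_monic (recCoeff L) (3 * n + 1 + 2)).ne_zero
    have hsum := recCoeff_three_mul_add hL hs hc n
    have hpos := recCoeff_succ_pos hL (3 * n + 3)
    have h4 : L (X ^ 4 * recPoly (recCoeff L) (3 * n + 1 + 2) ^ 2) =
        3 / 8 * L (recPoly (recCoeff L) (3 * n + 1 + 2) ^ 2) := by
      rw [show 3 * n + 1 + 2 = 3 * (n + 1) by ring, recPoly_three_mul hL hs hc, ← pow_comp,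
        mul_comm, hc.map_comp_mul_X_pow_four]
    have h5 := mul_right_cancel₀ h0.ne' (h.symm.trans h4)
    simp only [add_assoc, Nat.reduceAdd] at h5 hpos
    rw [ih, hsum] at h5
    rw [show 3 * (n + 1) + 2 = 3 * n + 5 by ring]
    -- The identity and the sum relation give `γ_{3n+4} γ_{3n+5} = γ_{3n+4} / 4`.
    refine mul_left_cancel₀ hpos.ne' ?_
    linarith

theorem recCoeff_three_mul_add_three_mul (hL : PosDefFunctional L) (hs : SymmFunctional L)
    (hc : IsCubicSieved L) (n : ℕ) : recCoeff L (3 * n + 3) * recCoeff L (3 * n + 1) =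
      1 / 4 * recCoeff (cubicPullback L) (n + 1) := by
  -- The factor `16 ^ k` undoes the square of the normalisation `4⁻ᵏ` in `P_{3k}`.
  have hnorm : ∀ k, (16 : ℝ) ^ k * L (recPoly (recCoeff L) (3 * k) ^ 2) =
      cubicPullback L (recPoly (recCoeff (cubicPullback L)) k ^ 2) := by
    intro k
    rw [recPoly_three_mul hL hs hc, ← pow_comp, mul_pow, ← C_pow, mul_comp, C_comp, map_C_mul,
      ← cubicPullback_apply, ← mul_assoc]
    have : (16 : ℝ) ^ k * ((4 ^ k)⁻¹) ^ 2 = 1 := by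
      rw [← inv_pow, ← pow_mul, mul_comm k 2, pow_mul, ← mul_pow]; norm_num
    rw [this, one_mul]
  have h0 := recCoeff_succ_mul hL.cubicPullback n
  rw [← hnorm, ← hnorm] at h0
  have h1 := recCoeff_succ_mul hL (3 * n)
  have h2 := recCoeff_succ_mul hL (3 * n + 1)
  have h3 := recCoeff_succ_mul hL (3 * n + 2)
  have hpos := hL _ (recPoly_monic (recCoeff L) (3 * n)).ne_zero
  have h16 : (0 : ℝ) < 16 ^ n := by positivity
  simp only [add_assoc, Nat.reduceAdd] at h1 h2 h3
  rw [show 3 * (n + 1) = 3 * n + 3 by ring, pow_succ (16 : ℝ), ← h3, ← h2, ← h1,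
    recCoeff_three_mul_add_two hL hs hc] at h0
  refine mul_right_cancel₀ (mul_pos h16 hpos).ne' ?_
  linarith

end Sieved

/-! ### The trigonometric functional -/

/-- The function `|sin (φ / 2)| + |cos (φ / 2)|`. -/
noncomputable def absSinCosHalf (φ : ℝ) : ℝ := |Real.sin (φ / 2)| + |Real.cos (φ / 2)|

theorem continuous_absSinCosHalf : Continuous absSinCosHalf := by
  unfold absSinCosHalf; fun_prop

theorem absSinCosHalf_pos (φ : ℝ) : 0 < absSinCosHalf φ := by
  have h := Real.sin_sq_add_cos_sq (φ / 2)
  unfold absSinCosHalf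
  by_contra! hle
  have h1 : |Real.sin (φ / 2)| = 0 := by
    linarith [abs_nonneg (Real.sin (φ / 2)), abs_nonneg (Real.cos (φ / 2))]
  have h2 : |Real.cos (φ / 2)| = 0 := by
    linarith [abs_nonneg (Real.sin (φ / 2)), abs_nonneg (Real.cos (φ / 2))]
  rw [abs_eq_zero] at h1 h2
  rw [h1, h2] at h
  norm_num at h

theorem absSinCosHalf_add_pi (φ : ℝ) : absSinCosHalf (φ + Real.pi) = absSinCosHalf φ := by
  unfold absSinCosHalf
  rw [add_div, Real.sin_add_pi_div_two, Real.cos_add_pi_div_two, abs_neg, add_comm]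

theorem absSinCosHalf_neg (φ : ℝ) : absSinCosHalf (-φ) = absSinCosHalf φ := by
  unfold absSinCosHalf
  rw [neg_div, Real.sin_neg, Real.cos_neg, abs_neg]

theorem periodic_absSinCosHalf : Function.Periodic absSinCosHalf (2 * Real.pi) := fun φ => by
  rw [two_mul, ← add_assoc, absSinCosHalf_add_pi, absSinCosHalf_add_pi]

/-- Integration against the weight `|sin (3θ/2)| + |cos (3θ/2)|` in the variable `x = cos θ`. -/
noncomputable def trigFunctional : ℝ[X] →ₗ[ℝ] ℝ where
  toFun p := ∫ θ in 0..2 * Real.pi, p.eval (Real.cos θ) * absSinCosHalf (3 * θ)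
  map_add' p q := by
    simp only [eval_add, add_mul]
    have := continuous_absSinCosHalf
    rw [intervalIntegral.integral_add] <;> exact (by fun_prop : Continuous _).intervalIntegrable _ _
  map_smul' a p := by
    simp [mul_assoc]

theorem trigFunctional_apply (p : ℝ[X]) :
    trigFunctional p = ∫ θ in 0..2 * Real.pi, p.eval (Real.cos θ) * absSinCosHalf (3 * θ) := rfl

theorem continuous_trigFunctional_integrand (p : ℝ[X]) :
    Continuous fun θ => p.eval (Real.cos θ) * absSinCosHalf (3 * θ) := by
  have := continuous_absSinCosHalf
  fun_prop

theorem periodic_trigFunctional_integrand (p : ℝ[X]) :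
    Function.Periodic (fun θ => p.eval (Real.cos θ) * absSinCosHalf (3 * θ)) (2 * Real.pi) := by
  intro θ
  have h := (periodic_absSinCosHalf.nsmul 3) (3 * θ)
  simp only [nsmul_eq_mul, Nat.cast_ofNat] at h
  simp only [Real.cos_add_two_pi]
  rw [mul_add, h]

theorem posDefFunctional_trigFunctional : PosDefFunctional trigFunctional := by
  intro p hp
  -- A nonroot `x` in `(-1, 1)` supplies the angle `arccos x` where the integrand is strictly
  -- positive.
  have hinf : (Set.Ioo (-1 : ℝ) 1).Infinite := Set.Ioo_infinite (by norm_num)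
  obtain ⟨x, hx, hxr⟩ := hinf.exists_notMem_finset p.roots.toFinset
  rw [Multiset.mem_toFinset, mem_roots hp, IsRoot.def] at hxr
  rw [trigFunctional_apply]
  refine intervalIntegral.integral_pos Real.two_pi_pos
    (continuous_trigFunctional_integrand _).continuousOn ?_ ⟨Real.arccos x, ?_, ?_⟩
  · intro θ _
    rw [eval_pow]
    exact mul_nonneg (sq_nonneg _) (absSinCosHalf_pos _).le
  · exact ⟨Real.arccos_nonneg x, (Real.arccos_le_pi x).trans (by linarith [Real.pi_pos])⟩
  · rw [Real.cos_arccos hx.1.le hx.2.le, eval_pow]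
    exact mul_pos (by positivity) (absSinCosHalf_pos _)

/-- The reflection `x ↦ -x` is the shift `θ ↦ θ + π`, which moves `3θ` by `π` modulo `2π`. -/
theorem symmFunctional_trigFunctional : SymmFunctional trigFunctional := by
  intro p
  have h := (periodic_trigFunctional_integrand p).intervalIntegral_add_eq Real.pi 0
  rw [zero_add] at h
  rw [trigFunctional_apply, trigFunctional_apply, ← h]
  rw [show Real.pi + 2 * Real.pi = 2 * Real.pi + Real.pi by ring]
  nth_rw 2 [← zero_add Real.pi]
  rw [← intervalIntegral.integral_comp_add_right (a := 0) (b := 2 * Real.pi)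
    (fun θ => p.eval (Real.cos θ) * absSinCosHalf (3 * θ))]
  congr 1
  ext θ
  rw [eval_comp, eval_neg, eval_X, Real.cos_add_pi,
    show 3 * (θ + Real.pi) = 3 * θ + Real.pi + 2 * Real.pi by ring, periodic_absSinCosHalf,
    absSinCosHalf_add_pi]

theorem eval_chebyshevCubic_cos (θ : ℝ) :
    chebyshevCubic.eval (Real.cos θ) = Real.cos (3 * θ) := by
  simp [chebyshevCubic, Real.cos_three_mul]

theorem integral_eq_average_of_periodic {f : ℝ → ℝ} (hf : Continuous f)
    (hp : Function.Periodic f (2 * Real.pi)) :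
    3 * ∫ θ in 0..2 * Real.pi, f θ = ∫ θ in 0..2 * Real.pi,
      (f θ + f (θ + 2 * Real.pi / 3) + f (θ - 2 * Real.pi / 3)) := by
  have hshift : ∀ c, ∫ θ in 0..2 * Real.pi, f (θ + c) = ∫ θ in 0..2 * Real.pi, f θ := by
    intro c
    rw [intervalIntegral.integral_comp_add_right, zero_add, add_comm (2 * Real.pi),
      hp.intervalIntegral_add_eq c 0, zero_add]
  have hi : ∀ c, IntervalIntegrable (fun θ => f (θ + c)) volume 0 (2 * Real.pi) := fun c =>
    (hf.comp (continuous_id.add continuous_const)).intervalIntegrable _ _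
  simp only [sub_eq_add_neg]
  rw [intervalIntegral.integral_add ((hf.intervalIntegrable _ _).add (hi _)) (hi _),
    intervalIntegral.integral_add (hf.intervalIntegrable _ _) (hi _), hshift, hshift]
  ring

/-- Functions of `3θ` are unchanged by shifts of `2π/3`, so only `r` is averaged. -/
theorem three_mul_trigFunctional_comp_mul (q r : ℝ[X]) :
    3 * trigFunctional (q.comp chebyshevCubic * r) =
      ∫ θ in 0..2 * Real.pi, (r.eval (Real.cos θ) + r.eval (Real.cos (θ + 2 * Real.pi / 3)) +
        r.eval (Real.cos (θ - 2 * Real.pi / 3))) *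
          (q.eval (Real.cos (3 * θ)) * absSinCosHalf (3 * θ)) := by
  rw [trigFunctional_apply, integral_eq_average_of_periodic (continuous_trigFunctional_integrand _)
    (periodic_trigFunctional_integrand _)]
  congr 1
  ext θ
  simp only [eval_mul, eval_comp, eval_chebyshevCubic_cos]
  rw [show 3 * (θ + 2 * Real.pi / 3) = 3 * θ + 2 * Real.pi by ring,
    show 3 * (θ - 2 * Real.pi / 3) = 3 * θ - 2 * Real.pi by ring, Real.cos_add_two_pi,
    Real.cos_sub_two_pi, periodic_absSinCosHalf, periodic_absSinCosHalf.sub_eq]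
  ring

theorem cos_two_pi_div_three : Real.cos (2 * Real.pi / 3) = -(1 / 2) := by
  rw [show 2 * Real.pi / 3 = Real.pi - Real.pi / 3 by ring, Real.cos_pi_sub, Real.cos_pi_div_three]

theorem isCubicSieved_trigFunctional : IsCubicSieved trigFunctional := by
  intro q
  have hsin : Real.sin (2 * Real.pi / 3) ^ 2 = 3 / 4 := by
    rw [Real.sin_sq, cos_two_pi_div_three]; norm_num
  constructor
  · have h := three_mul_trigFunctional_comp_mul q X
    rw [intervalIntegral.integral_congr (g := fun _ => 0)] at h
    · simpa using h
    · intro θ _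
      simp only [eval_X, Real.cos_add, Real.cos_sub, cos_two_pi_div_three]
      ring
  · have h := three_mul_trigFunctional_comp_mul q (X ^ 2)
    have h1 : trigFunctional (q.comp chebyshevCubic) = ∫ θ in 0..2 * Real.pi,
        q.eval (Real.cos (3 * θ)) * absSinCosHalf (3 * θ) := by
      simp only [trigFunctional_apply, eval_comp, eval_chebyshevCubic_cos]
    rw [intervalIntegral.integral_congr (g := fun θ => 3 / 2 *
      (q.eval (Real.cos (3 * θ)) * absSinCosHalf (3 * θ))),
      intervalIntegral.integral_const_mul, ← h1] at h
    · linarith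
    · intro θ _
      simp only [eval_pow, eval_X, Real.cos_add, Real.cos_sub, cos_two_pi_div_three]
      congr 1
      linear_combination 2 * Real.sin θ ^ 2 * hsin + 3 / 2 * Real.sin_sq_add_cos_sq θ

/-! ### Moments and first coefficients of the pullback -/

theorem cubicPullback_trigFunctional (q : ℝ[X]) : cubicPullback trigFunctional q =
    ∫ φ in 0..2 * Real.pi, q.eval (Real.cos φ) * absSinCosHalf φ := by
  have hp : Function.Periodic (fun φ => q.eval (Real.cos φ) * absSinCosHalf φ) (2 * Real.pi) :=
    fun φ => by simp only [Real.cos_add_two_pi, periodic_absSinCosHalf φ]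
  have hint : ∀ a b, IntervalIntegrable (fun φ => q.eval (Real.cos φ) * absSinCosHalf φ)
      volume a b := fun a b => by
    have := continuous_absSinCosHalf
    exact (by fun_prop : Continuous _).intervalIntegrable _ _
  simp only [cubicPullback_apply, trigFunctional_apply, eval_comp, eval_chebyshevCubic_cos]
  rw [intervalIntegral.integral_comp_mul_left (fun φ => q.eval (Real.cos φ) * absSinCosHalf φ)
    three_ne_zero, mul_zero]
  -- As `φ = 3θ` runs over three periods, the factor 3 cancels the Jacobian `1/3`.
  have h := hp.intervalIntegral_add_zsmul_eq 3 0 hint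
  simp only [zero_add, zsmul_eq_mul, Int.cast_ofNat] at h
  rw [h, smul_eq_mul, ← mul_assoc]
  norm_num

/-- A shift by `π` exchanges the sine and cosine terms, even powers of `cos φ` being unaffected.
Then substitute `u = cos(φ/2)`, with `sin(φ/2) ≥ 0` on `[0, 2π]`. -/
theorem cubicPullback_trigFunctional_X_pow (k : ℕ) : cubicPullback trigFunctional (X ^ (2 * k)) =
    4 * ∫ u in -1..1, (2 * u ^ 2 - 1) ^ (2 * k) := by
  have hp : Function.Periodic (fun φ => Real.cos φ ^ (2 * k) * |Real.sin (φ / 2)|)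
      (2 * Real.pi) := fun φ => by
    simp only [Real.cos_add_two_pi]
    rw [show (φ + 2 * Real.pi) / 2 = φ / 2 + Real.pi by ring, Real.sin_add_pi, abs_neg]
  have hcos : ∫ φ in 0..2 * Real.pi, Real.cos φ ^ (2 * k) * |Real.cos (φ / 2)| =
      ∫ φ in 0..2 * Real.pi, Real.cos φ ^ (2 * k) * |Real.sin (φ / 2)| := by
    have h := hp.intervalIntegral_add_eq Real.pi 0
    rw [zero_add] at h
    rw [← h, show Real.pi + 2 * Real.pi = 2 * Real.pi + Real.pi by ring]
    nth_rw 2 [← zero_add Real.pi]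
    rw [← intervalIntegral.integral_comp_add_right (a := 0) (b := 2 * Real.pi)
      (fun φ => Real.cos φ ^ (2 * k) * |Real.sin (φ / 2)|)]
    congr 1
    ext φ
    rw [Real.cos_add_pi, add_div, Real.sin_add_pi_div_two, (even_two_mul k).neg_pow]
  have hsin : ∫ φ in 0..2 * Real.pi, Real.cos φ ^ (2 * k) * |Real.sin (φ / 2)| =
      2 * ∫ u in -1..1, (2 * u ^ 2 - 1) ^ (2 * k) := by
    have h := intervalIntegral.integral_comp_mul_deriv (a := 0) (b := 2 * Real.pi)
      (f := fun φ => Real.cos (φ / 2)) (f' := fun φ => -Real.sin (φ / 2) * (1 / 2))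
      (g := fun u : ℝ => (2 * u ^ 2 - 1) ^ (2 * k))
      (fun φ _ => ((hasDerivAt_id φ).div_const 2).cos) (by fun_prop) (by fun_prop)
    rw [zero_div, Real.cos_zero, mul_div_cancel_left₀ _ two_ne_zero, Real.cos_pi,
      intervalIntegral.integral_symm (-1) 1, ← neg_eq_iff_eq_neg] at h
    rw [← h, ← intervalIntegral.integral_neg, ← intervalIntegral.integral_const_mul]
    refine intervalIntegral.integral_congr fun φ hφ => ?_
    rw [Set.uIcc_of_le Real.two_pi_pos.le] at hφ
    have h0 : 0 ≤ Real.sin (φ / 2) :=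
      Real.sin_nonneg_of_nonneg_of_le_pi (by linarith [hφ.1]) (by linarith [hφ.2])
    have h1 : Real.cos φ = 2 * Real.cos (φ / 2) ^ 2 - 1 := by
      rw [← Real.cos_two_mul]; ring_nf
    simp only [Function.comp_apply, abs_of_nonneg h0, h1]
    ring
  rw [cubicPullback_trigFunctional]
  simp only [eval_pow, eval_X, absSinCosHalf, mul_add]
  rw [intervalIntegral.integral_add
    ((by fun_prop : Continuous _).intervalIntegrable _ _)
    ((by fun_prop : Continuous _).intervalIntegrable _ _), hcos, hsin]
  ring

theorem integral_pow_comp_two_mul_sq_sub_one :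
    (∫ u in (-1 : ℝ)..1, (2 * u ^ 2 - 1) ^ 2) = 14 / 15 ∧
    (∫ u in (-1 : ℝ)..1, (2 * u ^ 2 - 1) ^ 4) = 214 / 315 ∧
    (∫ u in (-1 : ℝ)..1, (2 * u ^ 2 - 1) ^ 6) = 1670 / 3003 := by
  have key : ∀ R f : ℝ[X], derivative R = f →
      ∫ u in (-1 : ℝ)..1, f.eval u = R.eval 1 - R.eval (-1) := by
    rintro R f rfl
    exact intervalIntegral.integral_eq_sub_of_hasDerivAt (fun u _ => R.hasDerivAt u)
      ((by fun_prop : Continuous _).intervalIntegrable _ _)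
  refine ⟨?_, ?_, ?_⟩
  · have h := key (C (4 / 5) * X ^ 5 - C (4 / 3) * X ^ 3 + X) ((C 2 * X ^ 2 - 1) ^ 2) ?_
    · simpa using h.trans (by norm_num)
    · refine funext fun u => ?_
      simp; ring
  · have h := key (C (16 / 9) * X ^ 9 - C (32 / 7) * X ^ 7 + C (24 / 5) * X ^ 5
      - C (8 / 3) * X ^ 3 + X) ((C 2 * X ^ 2 - 1) ^ 4) ?_
    · simpa using h.trans (by norm_num)
    · refine funext fun u => ?_
      simp; ring
  · have h := key (C (64 / 13) * X ^ 13 - C (192 / 11) * X ^ 11 + C (240 / 9) * X ^ 9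
      - C (160 / 7) * X ^ 7 + C (60 / 5) * X ^ 5 - C (12 / 3) * X ^ 3 + X)
      ((C 2 * X ^ 2 - 1) ^ 6) ?_
    · simpa using h.trans (by norm_num)
    · refine funext fun u => ?_
      simp; ring

/-- Expand the squared norms of the monic polynomials of degrees 1, 2, 3 in the even moments and
take successive ratios. -/
theorem recCoeff_of_moments {M : ℝ[X] →ₗ[ℝ] ℝ} (hM : PosDefFunctional M) {c : ℝ}
    (h0 : M 1 = c) (h2 : M (X ^ 2) = 7 / 15 * c) (h4 : M (X ^ 4) = 107 / 315 * c)
    (h6 : M (X ^ 6) = 835 / 3003 * c) :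
    recCoeff M 1 = 7 / 15 ∧ recCoeff M 2 = 64 / 245 ∧ recCoeff M 3 = 15935 / 63063 := by
  have hc : 0 < c := by simpa [h0] using hM 1 one_ne_zero
  have e1 := recCoeff_succ_mul hM 0
  have e2 := recCoeff_succ_mul hM 1
  have e3 := recCoeff_succ_mul hM 2
  simp only [recPoly, zero_add, Nat.reduceAdd, one_pow, h0, h2] at e1 e2 e3
  have c1 : recCoeff M 1 = 7 / 15 := mul_right_cancel₀ hc.ne' e1
  rw [c1] at e2 e3
  have q2 : M ((X * X - C (7 / 15) * 1) ^ 2) = (107 / 315 - (7 / 15) ^ 2) * c := by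
    have : ((X * X - C (7 / 15) * 1) ^ 2 : ℝ[X]) = X ^ 4 - C (2 * (7 / 15)) * X ^ 2
        + C ((7 / 15) ^ 2) * 1 := by simp only [C_mul, C_pow, C_ofNat]; ring
    rw [this, map_add, map_sub, map_C_mul, map_C_mul, h0, h2, h4]
    ring
  rw [q2] at e2 e3
  have c2 : recCoeff M 2 = 64 / 245 := by
    refine mul_right_cancel₀ hc.ne' ?_
    linarith
  rw [c2] at e3
  have q3 : M ((X * (X * X - C (7 / 15) * 1) - C (64 / 245) * X) ^ 2) =
      (835 / 3003 - 2 * (7 / 15 + 64 / 245) * (107 / 315)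
        + (7 / 15 + 64 / 245) ^ 2 * (7 / 15)) * c := by
    have : ((X * (X * X - C (7 / 15) * 1) - C (64 / 245) * X) ^ 2 : ℝ[X]) = X ^ 6
        - C (2 * (7 / 15 + 64 / 245)) * X ^ 4 + C ((7 / 15 + 64 / 245) ^ 2) * X ^ 2 := by
      simp only [C_mul, C_pow, C_ofNat, C_add]; ring
    rw [this, map_add, map_sub, map_C_mul, map_C_mul, h2, h4, h6]
    ring
  rw [q3] at e3
  refine ⟨c1, c2, mul_right_cancel₀ hc.ne' ?_⟩
  linarith

theorem recCoeff_cubicPullback_trigFunctional :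
    recCoeff (cubicPullback trigFunctional) 1 = 7 / 15 ∧
    recCoeff (cubicPullback trigFunctional) 2 = 64 / 245 ∧
    recCoeff (cubicPullback trigFunctional) 3 = 15935 / 63063 := by
  obtain ⟨h2, h4, h6⟩ := integral_pow_comp_two_mul_sq_sub_one
  have m0 := cubicPullback_trigFunctional_X_pow 0
  have m1 := cubicPullback_trigFunctional_X_pow 1
  have m2 := cubicPullback_trigFunctional_X_pow 2
  have m3 := cubicPullback_trigFunctional_X_pow 3
  simp only [mul_zero, mul_one, Nat.reduceMul, pow_zero, h2, h4, h6] at m0 m1 m2 m3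
  refine recCoeff_of_moments posDefFunctional_trigFunctional.cubicPullback (c := 8) ?_ ?_ ?_ ?_
  · rw [m0]; norm_num
  · rw [m1]; norm_num
  · rw [m2]; norm_num
  · rw [m3]; norm_num

/-! ### From the weight on `(-1, 1)` to the trigonometric functional -/

/-- The weight `atiaWeight` multiplied by `√(1 - x ^ 2)`. -/
noncomputable def atiaDensity (x : ℝ) : ℝ :=
  |x + 1 / 2| * √(1 - x) + |x - 1 / 2| * √(1 + x)

theorem continuous_atiaDensity : Continuous atiaDensity := by
  unfold atiaDensity; fun_prop

theorem atiaWeight_eq {x : ℝ} (hx : x ∈ Set.Ioo (-1 : ℝ) 1) :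
    atiaWeight x = atiaDensity x * √(1 - x ^ 2)⁻¹ := by
  have h1 : 0 < 1 + x := by linarith [hx.1]
  have h2 : 0 < 1 - x := by linarith [hx.2]
  have s1 := (Real.sqrt_pos.2 h1).ne'
  have s2 := (Real.sqrt_pos.2 h2).ne'
  rw [atiaWeight, atiaDensity, Real.sqrt_inv, show 1 - x ^ 2 = (1 + x) * (1 - x) by ring,
    Real.sqrt_mul h1.le]
  field_simp

theorem integrableOn_eval_mul_atiaWeight (p : ℝ[X]) :
    IntegrableOn (fun x => p.eval x * atiaWeight x) (Set.Ioo (-1) 1) := by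
  have hc := continuous_atiaDensity
  have h := Chebyshev.intervalIntegrable_sqrt_one_sub_sq_inv.continuousOn_mul
    (by fun_prop : Continuous fun x => p.eval x * atiaDensity x).continuousOn
  rw [intervalIntegrable_iff, Set.uIoc_of_le (by norm_num)] at h
  refine (h.mono_set Set.Ioo_subset_Ioc_self).congr_fun (fun x hx => ?_) measurableSet_Ioo
  simp only [atiaWeight_eq hx, mul_assoc]

/-- With `α = θ/2`, `sin 3α = (2 cos 2α + 1) sin α` and `cos 3α = (2 cos 2α - 1) cos α` produce the
factors `|x ± 1/2|`. -/
theorem atiaDensity_cos {θ : ℝ} (h0 : 0 ≤ θ) (hpi : θ ≤ Real.pi) :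
    atiaDensity (Real.cos θ) = √2 / 2 * absSinCosHalf (3 * θ) := by
  have hs : 0 ≤ Real.sin (θ / 2) :=
    Real.sin_nonneg_of_nonneg_of_le_pi (by linarith) (by linarith)
  have hc : 0 ≤ Real.cos (θ / 2) :=
    Real.cos_nonneg_of_neg_pi_div_two_le_of_le (by linarith) (by linarith)
  have hsc := Real.sin_sq_add_cos_sq (θ / 2)
  have hcos : Real.cos θ = 2 * Real.cos (θ / 2) ^ 2 - 1 := by
    rw [← Real.cos_two_mul]; ring_nf
  have e1 : √(1 - Real.cos θ) = √2 * Real.sin (θ / 2) := by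
    rw [show 1 - Real.cos θ = 2 * Real.sin (θ / 2) ^ 2 by rw [hcos]; linarith,
      Real.sqrt_mul zero_le_two, Real.sqrt_sq hs]
  have e2 : √(1 + Real.cos θ) = √2 * Real.cos (θ / 2) := by
    rw [show 1 + Real.cos θ = 2 * Real.cos (θ / 2) ^ 2 by rw [hcos]; ring,
      Real.sqrt_mul zero_le_two, Real.sqrt_sq hc]
  have f1 : |Real.sin (3 * θ / 2)| = 2 * |Real.cos θ + 1 / 2| * Real.sin (θ / 2) := by
    rw [show 3 * θ / 2 = 3 * (θ / 2) by ring, Real.sin_three_mul,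
      show 3 * Real.sin (θ / 2) - 4 * Real.sin (θ / 2) ^ 3 =
        2 * (Real.cos θ + 1 / 2) * Real.sin (θ / 2) by
          rw [hcos]; linear_combination -4 * Real.sin (θ / 2) * hsc,
      abs_mul, abs_mul, abs_of_nonneg hs, abs_two]
  have f2 : |Real.cos (3 * θ / 2)| = 2 * |Real.cos θ - 1 / 2| * Real.cos (θ / 2) := by
    rw [show 3 * θ / 2 = 3 * (θ / 2) by ring, Real.cos_three_mul,
      show 4 * Real.cos (θ / 2) ^ 3 - 3 * Real.cos (θ / 2) =
        2 * (Real.cos θ - 1 / 2) * Real.cos (θ / 2) by rw [hcos]; ring,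
      abs_mul, abs_mul, abs_of_nonneg hc, abs_two]
  rw [atiaDensity, absSinCosHalf, e1, e2, f1, f2]
  ring

/-- The constant is `√2/2` from `atiaDensity_cos`, halved because `[0, 2π]` covers `(-1, 1)` twice.
-/
theorem integral_eval_mul_atiaWeight (p : ℝ[X]) :
    ∫ x in Set.Ioo (-1) 1, p.eval x * atiaWeight x = √2 / 4 * trigFunctional p := by
  have hhalf : trigFunctional p = 2 * ∫ θ in 0..Real.pi,
      p.eval (Real.cos θ) * absSinCosHalf (3 * θ) := by
    have hi := fun a b =>
      (continuous_trigFunctional_integrand p).intervalIntegrable (μ := volume) a b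
    have hrefl : ∫ θ in Real.pi..2 * Real.pi, p.eval (Real.cos θ) * absSinCosHalf (3 * θ) =
        ∫ θ in 0..Real.pi, p.eval (Real.cos θ) * absSinCosHalf (3 * θ) := by
      have h := intervalIntegral.integral_comp_sub_left (a := 0) (b := Real.pi)
        (fun θ => p.eval (Real.cos θ) * absSinCosHalf (3 * θ)) (2 * Real.pi)
      rw [sub_zero, show 2 * Real.pi - Real.pi = Real.pi by ring] at h
      rw [← h]
      congr 1
      ext θ
      have h3 := periodic_trigFunctional_integrand p (-θ)
      simp only [Real.cos_neg] at h3
      rw [show 2 * Real.pi - θ = -θ + 2 * Real.pi by ring, h3, mul_neg, absSinCosHalf_neg]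
    rw [trigFunctional_apply, ← intervalIntegral.integral_add_adjacent_intervals (hi 0 Real.pi)
      (hi _ _), hrefl, two_mul]
  have h := Chebyshev.integral_measureT fun x => p.eval x * atiaDensity x
  rw [Chebyshev.integral_measureT_eq_integral_cos,
    intervalIntegral.integral_of_le (by norm_num : (-1 : ℝ) ≤ 1),
    integral_Ioc_eq_integral_Ioo] at h
  rw [setIntegral_congr_fun measurableSet_Ioo
    (g := fun x => p.eval x * atiaDensity x * √(1 - x ^ 2)⁻¹)
    (fun x hx => by simp only [atiaWeight_eq hx, mul_assoc]), ← h, hhalf, ← mul_assoc,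
    ← intervalIntegral.integral_const_mul]
  refine intervalIntegral.integral_congr fun θ hθ => ?_
  rw [Set.uIcc_of_le Real.pi_pos.le] at hθ
  simp only [atiaDensity_cos hθ.1 hθ.2]
  ring

theorem isOrthogonalSeq_atiaWeight :
    IsOrthogonalSeq (recPoly (recCoeff trigFunctional)) atiaWeight (-1) 1 where
  degree_eq := recPoly_degree _
  integrable := integrableOn_eval_mul_atiaWeight
  orthogonal m n h := by
    simp only [← eval_mul]
    rw [integral_eval_mul_atiaWeight, map_recPoly_mul_of_ne posDefFunctional_trigFunctional
      symmFunctional_trigFunctional h, mul_zero]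
  norm_pos n := by
    simp only [← eval_pow]
    rw [integral_eval_mul_atiaWeight]
    exact mul_pos (by positivity) (posDefFunctional_trigFunctional _ (recPoly_monic _ n).ne_zero)

/-! ### Assembly -/

theorem mainTheorem2 :
    ∃ γ : ℕ → ℝ,
      (∀ n, 1 ≤ n → 0 < γ n) ∧
      γ 1 = 1 / 2 ∧
      (∀ n, γ (3 * n + 2) = 1 / 4) ∧
      (∀ n, γ (3 * n + 3) + γ (3 * n + 4) = 1 / 2) ∧
      γ 3 = 7 / 30 ∧ γ 4 = 4 / 15 ∧
      γ 6 = 12 / 49 ∧ γ 7 = 25 / 98 ∧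
      γ 9 = 3187 / 12870 ∧ γ 10 = 1624 / 6435 ∧
      IsOrthogonalSeq (recPoly γ) atiaWeight (-1) 1 := by
  have hL := posDefFunctional_trigFunctional
  have hs := symmFunctional_trigFunctional
  have hc := isCubicSieved_trigFunctional
  obtain ⟨c1, c2, c3⟩ := recCoeff_cubicPullback_trigFunctional
  have g1 := recCoeff_one hL hc
  have hsum := recCoeff_three_mul_add hL hs hc
  have hprod := recCoeff_three_mul_add_three_mul hL hs hc
  have s0 := hsum 0
  have s1 := hsum 1
  have s2 := hsum 2
  have p0 := hprod 0
  have p1 := hprod 1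
  have p2 := hprod 2
  norm_num only [c1, c2, c3, g1] at s0 s1 s2 p0 p1 p2
  -- Alternately, the product relation gives `γ_{3n+3}` from `γ_{3n+1}`, and the sum relation then
  -- gives `γ_{3n+4}`.
  have g3 : recCoeff trigFunctional 3 = 7 / 30 := by linarith
  have g4 : recCoeff trigFunctional 4 = 4 / 15 := by linarith
  rw [g4] at p1
  have g6 : recCoeff trigFunctional 6 = 12 / 49 := by linarith
  have g7 : recCoeff trigFunctional 7 = 25 / 98 := by linarith
  rw [g7] at p2
  have g9 : recCoeff trigFunctional 9 = 3187 / 12870 := by linarith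
  have g10 : recCoeff trigFunctional 10 = 1624 / 6435 := by linarith
  refine ⟨recCoeff trigFunctional, fun n hn => ?_, g1, recCoeff_three_mul_add_two hL hs hc, hsum,
    g3, g4, g6, g7, g9, g10, isOrthogonalSeq_atiaWeight⟩
  obtain ⟨k, rfl⟩ := Nat.exists_eq_add_of_le' hn
  exact recCoeff_succ_pos hL k
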